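/- Let $H$ be a complex Hilbert space. By a *von Neumann algebra on $H$* we mean a $*$-subalgebra $M$ of $B(H)$ that has a unit $e$ (a projection of $H$, not necessarily the identity operator) and is equal to its double commutant when regarded as an algebra of operators on $eH$; equivalently, $M=\{x\in M'' : ex=x=xe\}$, where $M''$ is the double commutant in $B(H)$. It is called *$\sigma$-finite* if every set of mutually orthogonal nonzero projections in $M$ is countable. A *Borel $*$-algebra on $H$* is a norm-closed $*$-subalgebra $A$ of $B(H)$ (not assumed to contain the identity operator) whose Hermitian part $A_{sa}$ is monotone sequentially closed in $B(H)_{sa}$: for each increasing sequence $(j_n)$ in $A_{sa}$ that is bounded above in $B(H)_{sa}$, the supremum $\sup_n j_n$ formed in $B(H)_{sa}$ belongs to $A_{sa}$. Let $M$ be a $\sigma$-finite von Neumann algebra on $H$, and let $A \subseteq M$ be a Borel $*$-algebra on $H$. Then $A$ is a von Neumann algebra on $H$. -/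

import Mathlib

/-- A subset `V` of an ordered space `W` is monotone sequentially closed in `W` if it contains the
supremum in `W` of each increasing sequence in `V` that is upper bounded in `W`. -/
def MonotoneSeqClosed {W : Type*} [Preorder W] (V : Set W) : Prop :=
  ∀ j : ℕ → W, Monotone j → (∀ n, j n ∈ V) → BddAbove (Set.range j) →
    ∀ s : W, IsLUB (Set.range j) s → s ∈ V

namespace NonUnitalStarSubalgebra

variable {H : Type*} [NormedAddCommGroup H] [InnerProductSpace ℂ H] [CompleteSpace H]

/-- The Hermitian part of a *-algebra of bounded operators on `H`, as a subset of the Hermitian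
part of `B(H)`, which carries the usual (Loewner) order of operators. -/
def hermitianPart (A : NonUnitalStarSubalgebra ℂ (H →L[ℂ] H)) :
    Set (selfAdjoint (H →L[ℂ] H)) :=
  {a | (a : H →L[ℂ] H) ∈ A}

/-- A Borel *-algebra on `H`: a C*-algebra of bounded operators on `H` (a norm-closed
*-subalgebra of `B(H)`, not assumed to contain the identity operator) whose Hermitian part is
monotone sequentially closed in the Hermitian part of `B(H)`. -/
structure IsBorelStarAlgebra (A : NonUnitalStarSubalgebra ℂ (H →L[ℂ] H)) : Prop where
  isClosed : IsClosed (A : Set (H →L[ℂ] H))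
  monotoneSeqClosed : MonotoneSeqClosed A.hermitianPart

/-- A *-algebra `A` of bounded operators on `H` is a von Neumann algebra if it has a unit `e`
(a projection of `H`, possibly different from the identity operator) and, with `A''` its double
commutant in `B(H)`, one has `A = {x ∈ A'' | e x = x = x e}`. In other words, `A` vanishes on the
orthogonal complement of `e H` and equals its double commutant as an algebra of operators on `e H`.
If `e = 1`, this says `A = A''`. -/
def IsVonNeumannAlgebra (A : NonUnitalStarSubalgebra ℂ (H →L[ℂ] H)) : Prop :=
  ∃ e ∈ A, IsStarProjection e ∧
    ∀ x : H →L[ℂ] H, x ∈ A ↔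
      x ∈ Set.centralizer (Set.centralizer (A : Set (H →L[ℂ] H))) ∧ e * x = x ∧ x * e = x

/-- `A` is σ-finite (countably decomposable): each set of mutually orthogonal (nonzero)
projections in `A` is countable. -/
def IsSigmaFinite (A : NonUnitalStarSubalgebra ℂ (H →L[ℂ] H)) : Prop :=
  ∀ P : Set (H →L[ℂ] H), (∀ p ∈ P, p ∈ A ∧ IsStarProjection p ∧ p ≠ 0) →
    P.Pairwise (fun p q => p * q = 0) → P.Countable

end NonUnitalStarSubalgebra

/-! ### Double commutants and strong* approximation. -/

namespace NonUnitalStarSubalgebra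

open scoped InnerProductSpace

/-! It suffices that `A` contain each projection `p` of `A''` that vanishes on the common kernel of
`A`: binary expansion then yields the positive contractions as norm limits, and the projection onto
the complement of the common kernel is the unit.

By σ-finiteness, `M` has a separating sequence `ξ i` (`IsSigmaFinite.exists_countable_separating`),
so it is enough to find `y ∈ A` with `y (ξ i) = p (ξ i)` for all `i`. Put `η i = ξ i - p (ξ i)` and
`ζ i = p (ξ i)`. The double commutant theorem gives `c k ∈ A` such that, for `i ≤ k`, `c k (η i)` is
at most `2⁻ᵏ` in norm while `2⁻ᵏ (c k)* ζ i` is within `2⁻ᵏ` of `ζ i`. The `c k` need not be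
bounded, but `T ↦ T (1 + T)⁻¹` is operator monotone and takes positive operators to positive
contractions. Applied to the sums of `(c k)* c k` over `n ≤ k < m`, it increases with `m` and
decreases with `n`; the supremum over `m` followed by the infimum over `n` stays in `A`, kills each
`η i` and fixes each `ζ i` (`IsBorelStarAlgebra.exists_mem_apply_eq`). -/

theorem commute_starProjection_of_invariant {E : Type*} [NormedAddCommGroup E]
    [InnerProductSpace ℂ E] (K : Submodule ℂ E) [K.HasOrthogonalProjection] {T S : E →L[ℂ] E}
    (hTS : ∀ u v, ⟪T u, v⟫_ℂ = ⟪u, S v⟫_ℂ) (hT : ∀ v ∈ K, T v ∈ K) (hS : ∀ v ∈ K, S v ∈ K) :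
    Commute T K.starProjection := by
  ext v
  refine (Submodule.eq_starProjection_of_mem_orthogonal (u := T v)
    (hT _ (K.starProjection_apply_mem v)) ?_).symm
  rw [← map_sub, Submodule.mem_orthogonal']
  intro u hu
  rw [hTS]
  exact Submodule.inner_left_of_mem_orthogonal (hS u hu)
    (K.sub_starProjection_mem_orthogonal v)

/-- Closures of real-linear subspaces are determined by real parts of inner products. -/
theorem mem_closure_of_re_inner_eq_zero {E : Type*} [NormedAddCommGroup E]
    [InnerProductSpace ℂ E] [CompleteSpace E] (V : AddSubgroup E)
    (hV : ∀ (r : ℝ), ∀ w ∈ V, (r : ℂ) • w ∈ V) {v : E}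
    (hv : ∀ u, (∀ w ∈ V, (⟪u, w⟫_ℂ).re = 0) → (⟪u, v⟫_ℂ).re = 0) : v ∈ closure (V : Set E) := by
  let _ : InnerProductSpace ℝ E := InnerProductSpace.rclikeToReal ℂ E
  let W : @Submodule ℝ E _ _ (InnerProductSpace.toNormedSpace (𝕜 := ℝ)).toModule :=
    { V with smul_mem' := hV }
  have : v ∈ Wᗮᗮ := by
    refine (Submodule.mem_orthogonal _ _).2 fun u hu => ?_
    rw [real_inner_eq_re_inner ℂ]
    refine hv u fun w hw => ?_
    have := (Submodule.mem_orthogonal' _ _).1 hu w hw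
    rwa [real_inner_eq_re_inner ℂ] at this
  rw [Submodule.orthogonal_orthogonal_eq_closure] at this
  exact this

variable {H : Type*} [NormedAddCommGroup H] [InnerProductSpace ℂ H]

/-- The operator acting as `a` in each coordinate of a finite power of `H`. -/
noncomputable def diagonal (ι : Type*) [Fintype ι] (a : H →L[ℂ] H) :
    PiLp 2 (fun _ : ι => H) →L[ℂ] PiLp 2 (fun _ : ι => H) :=
  (PiLp.continuousLinearEquiv 2 ℂ (fun _ : ι => H)).symm.toContinuousLinearMap ∘L
    ContinuousLinearMap.pi fun i => a ∘L PiLp.proj 2 (fun _ : ι => H) i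

@[simp]
theorem diagonal_apply {ι : Type*} [Fintype ι] (a : H →L[ℂ] H) (u : PiLp 2 (fun _ : ι => H))
    (i : ι) : diagonal ι a u i = a (u i) := rfl

/-- The `j`-th coordinate embedding into a finite power of `H`. -/
noncomputable def coordEmbedding {ι : Type*} [Fintype ι] [DecidableEq ι] (j : ι) :
    H →L[ℂ] PiLp 2 (fun _ : ι => H) :=
  (PiLp.continuousLinearEquiv 2 ℂ (fun _ : ι => H)).symm.toContinuousLinearMap ∘L
    ContinuousLinearMap.single ℂ (fun _ : ι => H) j

theorem coordEmbedding_apply {ι : Type*} [Fintype ι] [DecidableEq ι] (j : ι) (v : H) (i : ι) :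
    coordEmbedding j v i = if i = j then v else 0 := by
  change (Pi.single j v : ι → H) i = _
  rw [Pi.single_apply]

theorem sum_coordEmbedding {ι : Type*} [Fintype ι] [DecidableEq ι]
    (u : PiLp 2 (fun _ : ι => H)) : ∑ j, coordEmbedding j (u j) = u := by
  ext i
  simp [coordEmbedding_apply]

theorem diagonal_coordEmbedding {ι : Type*} [Fintype ι] [DecidableEq ι] (a : H →L[ℂ] H) (j : ι)
    (v : H) : diagonal ι a (coordEmbedding j v) = coordEmbedding j (a v) := by
  ext i
  simp only [diagonal_apply, coordEmbedding_apply]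
  split <;> simp

/-- An operator on a finite power of `H` that commutes with the diagonal action of a set of
operators commutes with the diagonal action of its double commutant. -/
theorem commute_diagonal_of_mem_centralizer_centralizer {ι : Type*} [Fintype ι]
    {S : Set (H →L[ℂ] H)} {Q : PiLp 2 (fun _ : ι => H) →L[ℂ] PiLp 2 (fun _ : ι => H)}
    (hQ : ∀ a ∈ S, ∀ u, diagonal ι a (Q u) = Q (diagonal ι a u)) {x : H →L[ℂ] H}
    (hx : x ∈ Set.centralizer (Set.centralizer S)) (u : PiLp 2 (fun _ : ι => H)) :
    diagonal ι x (Q u) = Q (diagonal ι x u) := by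
  classical
  -- The matrix entries of `Q` lie in the commutant of `S`, hence commute with `x`.
  have hmat : ∀ i j, PiLp.proj 2 (fun _ : ι => H) i ∘L Q ∘L coordEmbedding j
      ∈ Set.centralizer S := by
    intro i j
    rw [Set.mem_centralizer_iff]
    intro a ha
    ext v
    change a (Q (coordEmbedding j v) i) = Q (coordEmbedding j (a v)) i
    rw [← diagonal_coordEmbedding, ← hQ a ha, diagonal_apply]
  have hxm : ∀ i j v, Q (coordEmbedding j (x v)) i = x (Q (coordEmbedding j v) i) := fun i j v =>
    congrArg (fun T : H →L[ℂ] H => T v) (Set.mem_centralizer_iff.1 hx _ (hmat i j))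
  ext i
  conv_lhs => rw [← sum_coordEmbedding u]
  conv_rhs => rw [← sum_coordEmbedding (diagonal ι x u)]
  simp [hxm]

variable [CompleteSpace H]

theorem inner_apply_star_right (a : H →L[ℂ] H) (u v : H) : ⟪u, star a v⟫_ℂ = ⟪a u, v⟫_ℂ := by
  rw [ContinuousLinearMap.star_eq_adjoint, ContinuousLinearMap.adjoint_inner_right]

theorem inner_apply_star_left (a : H →L[ℂ] H) (u v : H) : ⟪star a u, v⟫_ℂ = ⟪u, a v⟫_ℂ := by
  rw [ContinuousLinearMap.star_eq_adjoint, ContinuousLinearMap.adjoint_inner_left]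

theorem inner_diagonal_left {ι : Type*} [Fintype ι] (a : H →L[ℂ] H)
    (u v : PiLp 2 (fun _ : ι => H)) :
    ⟪diagonal ι a u, v⟫_ℂ = ⟪u, diagonal ι (star a) v⟫_ℂ := by
  simp [PiLp.inner_apply, inner_apply_star_right]

/-- A form of the double commutant theorem: a finite sum of matrix coefficients that vanishes on
a *-algebra `A` vanishes at each element of the double commutant that is zero on the common kernel
of `A`. -/
theorem sum_inner_eq_zero_of_mem_centralizer_centralizer {ι : Type*} [Fintype ι]
    {A : NonUnitalStarSubalgebra ℂ (H →L[ℂ] H)} {x : H →L[ℂ] H}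
    (hx : x ∈ Set.centralizer (Set.centralizer (A : Set (H →L[ℂ] H))))
    (hker : ∀ v, (∀ a ∈ A, a v = 0) → x v = 0) {ζ η : ι → H}
    (hA : ∀ b ∈ A, ∑ i, ⟪ζ i, b (η i)⟫_ℂ = 0) : ∑ i, ⟪ζ i, x (η i)⟫_ℂ = 0 := by
  let η' : PiLp 2 (fun _ : ι => H) := WithLp.toLp 2 η
  let ζ' : PiLp 2 (fun _ : ι => H) := WithLp.toLp 2 ζ
  let K₀ : Submodule ℂ (PiLp 2 (fun _ : ι => H)) :=
    { carrier := {u | ∃ b ∈ A, diagonal ι b η' = u}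
      add_mem' := by
        rintro _ _ ⟨b, hb, rfl⟩ ⟨c, hc, rfl⟩
        refine ⟨b + c, add_mem hb hc, ?_⟩
        ext i; simp
      zero_mem' := ⟨0, zero_mem _, by ext i; simp⟩
      smul_mem' := by
        rintro r _ ⟨b, hb, rfl⟩
        refine ⟨r • b, SMulMemClass.smul_mem r hb, ?_⟩
        ext i; simp }
  let K := K₀.topologicalClosure
  have : CompleteSpace K := K₀.isClosed_topologicalClosure.completeSpace_coe
  have hinv : ∀ a ∈ A, ∀ v ∈ K, diagonal ι a v ∈ K := by
    intro a ha
    have : K₀ ≤ K.comap (diagonal ι a).toLinearMap := by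
      rintro _ ⟨b, hb, rfl⟩
      refine K₀.le_topologicalClosure ⟨a * b, mul_mem ha hb, ?_⟩
      ext i; simp
    exact K₀.topologicalClosure_minimal this
      (K₀.isClosed_topologicalClosure.preimage (diagonal ι a).continuous)
  have hcomm : ∀ a ∈ A, ∀ u, diagonal ι a (K.starProjection u)
      = K.starProjection (diagonal ι a u) := fun a ha u =>
    congrArg (fun T : PiLp 2 (fun _ : ι => H) →L[ℂ] PiLp 2 (fun _ : ι => H) => T u) (commute_starProjection_of_invariant K
      (inner_diagonal_left a) (hinv a ha) (hinv _ (star_mem ha))).eq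
  -- Since `A` may lack the identity, `η'` need not lie in `K`; but its component orthogonal to `K`
  -- is killed by `A`, hence by `x`.
  have hw : ∀ i, x ((η' - K.starProjection η') i) = 0 := by
    intro i
    refine hker _ fun a ha => ?_
    rw [← diagonal_apply, map_sub, hcomm a ha, Submodule.starProjection_eq_self_iff.2
      (K₀.le_topologicalClosure ⟨a, ha, rfl⟩), sub_self]
    rfl
  have hmem : diagonal ι x η' ∈ K := by
    have h1 : diagonal ι x η' = diagonal ι x (K.starProjection η') := by
      rw [← sub_eq_zero, ← map_sub]
      ext i
      exact hw i
    rw [h1, commute_diagonal_of_mem_centralizer_centralizer hcomm hx]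
    exact K.starProjection_apply_mem _
  have hζ : K ≤ (ℂ ∙ ζ')ᗮ := by
    refine K₀.topologicalClosure_minimal ?_ (Submodule.isClosed_orthogonal _)
    rintro _ ⟨b, hb, rfl⟩
    rw [Submodule.mem_orthogonal_singleton_iff_inner_right, PiLp.inner_apply]
    exact hA b hb
  have := hζ hmem
  rwa [Submodule.mem_orthogonal_singleton_iff_inner_right, PiLp.inner_apply] at this

/-- Simultaneous strong* approximation of elements of the double commutant. -/
theorem exists_mem_norm_sub_lt_of_mem_centralizer_centralizer {ι : Type*} [Fintype ι]
    {A : NonUnitalStarSubalgebra ℂ (H →L[ℂ] H)} {x : H →L[ℂ] H}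
    (hx : x ∈ Set.centralizer (Set.centralizer (A : Set (H →L[ℂ] H))))
    (hker : ∀ v, (∀ a ∈ A, a v = 0) → x v = 0) (η ξ : ι → H) {ε : ℝ} (hε : 0 < ε) :
    ∃ b ∈ A, ∀ i, ‖b (η i) - x (η i)‖ < ε ∧ ‖star b (ξ i) - star x (ξ i)‖ < ε := by
  -- `L` is only real-linear, because `star` is conjugate-linear; hence the real orthogonality
  -- criterion.
  let L : (H →L[ℂ] H) → PiLp 2 (fun _ : ι ⊕ ι => H) := fun b =>
    WithLp.toLp 2 (Sum.elim (fun i => b (η i)) (fun i => star b (ξ i)))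
  let V : AddSubgroup (PiLp 2 (fun _ : ι ⊕ ι => H)) :=
    { carrier := {u | ∃ b ∈ A, L b = u}
      add_mem' := by
        rintro _ _ ⟨b, hb, rfl⟩ ⟨c, hc, rfl⟩
        refine ⟨b + c, add_mem hb hc, ?_⟩
        ext i; cases i <;> simp [L]
      zero_mem' := ⟨0, zero_mem _, by ext i; cases i <;> simp [L]⟩
      neg_mem' := by
        rintro _ ⟨b, hb, rfl⟩
        refine ⟨-b, neg_mem hb, ?_⟩
        ext i; cases i <;> simp [L] }
  have hmem : L x ∈ closure (V : Set (PiLp 2 (fun _ : ι ⊕ ι => H))) := by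
    refine mem_closure_of_re_inner_eq_zero V ?_ fun u hu => ?_
    · rintro r _ ⟨b, hb, rfl⟩
      refine ⟨(r : ℂ) • b, SMulMemClass.smul_mem _ hb, ?_⟩
      ext i; cases i <;> simp [L]
    -- Moving `star b` across the inner product and taking real parts replaces `⟪u, L b⟫` by a
    -- complex-linear functional. Its real part vanishes on `A`, so testing on `I • b` makes it
    -- vanish altogether.
    let φ : (H →L[ℂ] H) → ℂ := fun b =>
      ∑ i : ι ⊕ ι, ⟪Sum.elim (fun i => u (Sum.inl i)) ξ i,
        b (Sum.elim η (fun i => u (Sum.inr i)) i)⟫_ℂ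
    have hφ : ∀ b, (⟪u, L b⟫_ℂ).re = (φ b).re := by
      intro b
      simp only [φ, L, PiLp.inner_apply, Fintype.sum_sum_type, Sum.elim_inl, Sum.elim_inr,
        inner_apply_star_right, Complex.add_re, Complex.re_sum]
      congr 1
      refine Finset.sum_congr rfl fun i _ => ?_
      exact inner_re_symm (𝕜 := ℂ) _ _
    have hre : ∀ b ∈ A, (φ b).re = 0 := fun b hb => by
      rw [← hφ]
      exact hu _ ⟨b, hb, rfl⟩
    have hφI : ∀ b, φ (Complex.I • b) = Complex.I * φ b := fun b => by
      simp [φ, Finset.mul_sum, mul_add]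
    have hzero : ∀ b ∈ A, φ b = 0 := fun b hb => by
      refine Complex.ext (hre b hb) ?_
      have := hre _ (SMulMemClass.smul_mem Complex.I hb)
      rw [hφI] at this
      simpa using this
    rw [hφ, show φ x = 0 from sum_inner_eq_zero_of_mem_centralizer_centralizer hx hker hzero]
    rfl
  obtain ⟨_, ⟨b, hb, rfl⟩, hbx⟩ := Metric.mem_closure_iff.1 hmem ε hε
  rw [dist_comm, dist_eq_norm] at hbx
  refine ⟨b, hb, fun i => ⟨?_, ?_⟩⟩
  · exact (PiLp.norm_apply_le (L b - L x) (Sum.inl i)).trans_lt hbx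
  · exact (PiLp.norm_apply_le (L b - L x) (Sum.inr i)).trans_lt hbx

end NonUnitalStarSubalgebra

/-! ### Operator order and monotone strong limits. -/

namespace NonUnitalStarSubalgebra

open scoped InnerProductSpace
open Filter Topology

variable {H : Type*} [NormedAddCommGroup H] [InnerProductSpace ℂ H]

theorem re_inner_mono {S T : H →L[ℂ] H} (h : S ≤ T) (v : H) :
    (⟪S v, v⟫_ℂ).re ≤ (⟪T v, v⟫_ℂ).re := by
  have := ((ContinuousLinearMap.le_def S T).1 h).re_inner_nonneg_left v
  simpa [inner_sub_left] using this

theorem tendsto_re_inner {j : ℕ → H →L[ℂ] H} {s : H →L[ℂ] H}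
    (hs : ∀ v, Tendsto (fun n => j n v) atTop (𝓝 (s v))) (v : H) :
    Tendsto (fun n => (⟪j n v, v⟫_ℂ).re) atTop (𝓝 (⟪s v, v⟫_ℂ).re) :=
  (Complex.continuous_re.tendsto _).comp ((hs v).inner tendsto_const_nhds)

variable [CompleteSpace H]

theorem le_iff_re_inner_le {S T : H →L[ℂ] H} (hS : IsSelfAdjoint S) (hT : IsSelfAdjoint T) :
    S ≤ T ↔ ∀ v, (⟪S v, v⟫_ℂ).re ≤ (⟪T v, v⟫_ℂ).re := by
  rw [ContinuousLinearMap.le_def, ContinuousLinearMap.isPositive_def']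
  simp only [hT.sub hS, true_and, ContinuousLinearMap.reApplyInnerSelf_apply,
    sub_apply, inner_sub_left, map_sub, sub_nonneg]
  rfl

/-- This is `T² ≤ T`. It upgrades control of the quadratic form to control of the vector `T v`. -/
theorem norm_sq_apply_le_re_inner {T : H →L[ℂ] H} (h0 : 0 ≤ T) (h1 : T ≤ 1) (v : H) :
    ‖T v‖ ^ 2 ≤ (⟪T v, v⟫_ℂ).re := by
  have h2 : T ^ 2 ≤ T ^ 1 := CStarAlgebra.pow_antitone h0 h1 one_le_two
  have h3 := re_inner_mono h2 v
  have hT : star T = T := (IsSelfAdjoint.of_nonneg h0).star_eq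
  rw [pow_one, pow_two, mul_apply_eq_comp, ← inner_apply_star_right, hT] at h3
  rwa [← inner_self_eq_norm_sq (𝕜 := ℂ)]

theorem isSelfAdjoint_of_tendsto {j : ℕ → H →L[ℂ] H} (hsa : ∀ n, IsSelfAdjoint (j n))
    {s : H →L[ℂ] H} (hs : ∀ v, Tendsto (fun n => j n v) atTop (𝓝 (s v))) : IsSelfAdjoint s := by
  rw [ContinuousLinearMap.isSelfAdjoint_iff_isSymmetric]
  intro u v
  refine tendsto_nhds_unique ((hs u).inner (tendsto_const_nhds (x := v))) ?_
  refine ((tendsto_const_nhds (x := u)).inner (hs v)).congr fun n => ?_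
  exact ((ContinuousLinearMap.isSelfAdjoint_iff_isSymmetric.1 (hsa n)) u v).symm

theorem le_of_tendsto_apply {j k : ℕ → H →L[ℂ] H} (hj : ∀ n, IsSelfAdjoint (j n))
    (hk : ∀ n, IsSelfAdjoint (k n)) {s t : H →L[ℂ] H}
    (hs : ∀ v, Tendsto (fun n => j n v) atTop (𝓝 (s v)))
    (ht : ∀ v, Tendsto (fun n => k n v) atTop (𝓝 (t v))) (h : ∀ n, j n ≤ k n) : s ≤ t :=
  (le_iff_re_inner_le (isSelfAdjoint_of_tendsto hj hs) (isSelfAdjoint_of_tendsto hk ht)).2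
    fun v => le_of_tendsto_of_tendsto' (tendsto_re_inner hs v) (tendsto_re_inner ht v)
      fun n => re_inner_mono (h n) v

/-- A bounded increasing sequence of positive operators converges strongly. -/
theorem exists_tendsto_of_monotone {j : ℕ → H →L[ℂ] H} (hj : Monotone j) (h0 : ∀ n, 0 ≤ j n)
    (h1 : ∀ n, j n ≤ 1) : ∃ s : H →L[ℂ] H, ∀ v, Tendsto (fun n => j n v) atTop (𝓝 (s v)) := by
  have hconv : ∀ v, ∃ w, Tendsto (fun n => j n v) atTop (𝓝 w) := by
    intro v
    have hmono : Monotone fun n => (⟪j n v, v⟫_ℂ).re := fun m n h => re_inner_mono (hj h) v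
    have hbdd : BddAbove (Set.range fun n => (⟪j n v, v⟫_ℂ).re) :=
      ⟨(⟪(1 : H →L[ℂ] H) v, v⟫_ℂ).re, by
        rintro _ ⟨n, rfl⟩
        exact re_inner_mono (h1 n) v⟩
    have hc := (tendsto_atTop_ciSup hmono hbdd).cauchySeq
    refine cauchySeq_tendsto_of_complete (Metric.cauchySeq_iff'.2 fun ε hε => ?_)
    obtain ⟨N, hN⟩ := Metric.cauchySeq_iff'.1 hc (ε ^ 2) (by positivity)
    refine ⟨N, fun n hn => ?_⟩
    have h2 : ‖j n v - j N v‖ ^ 2 ≤ (⟪j n v, v⟫_ℂ).re - (⟪j N v, v⟫_ℂ).re := by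
      have := norm_sq_apply_le_re_inner (T := j n - j N) (sub_nonneg.2 (hj hn))
        ((sub_le_self _ (h0 N)).trans (h1 n)) v
      simpa [inner_sub_left] using this
    have h3 := hN n hn
    rw [Real.dist_eq] at h3
    rw [dist_eq_norm]
    exact lt_of_pow_lt_pow_left₀ 2 hε.le ((h2.trans (le_abs_self _)).trans_lt h3)
  choose f hf using hconv
  exact ⟨continuousLinearMapOfTendsto j (tendsto_pi_nhds.2 hf), hf⟩

theorem IsBorelStarAlgebra.mem_of_monotone_of_tendsto
    {A : NonUnitalStarSubalgebra ℂ (H →L[ℂ] H)} (hA : A.IsBorelStarAlgebra)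
    {j : ℕ → H →L[ℂ] H} (hj : Monotone j) (hjA : ∀ n, j n ∈ A) (hsa : ∀ n, IsSelfAdjoint (j n))
    {s : H →L[ℂ] H} (hs : ∀ v, Tendsto (fun n => j n v) atTop (𝓝 (s v))) : s ∈ A := by
  have hsS : IsSelfAdjoint s := isSelfAdjoint_of_tendsto hsa hs
  let j' : ℕ → selfAdjoint (H →L[ℂ] H) := fun n => ⟨j n, hsa n⟩
  have hlub : IsLUB (Set.range j') ⟨s, hsS⟩ := by
    refine ⟨?_, fun t ht => ?_⟩
    · rintro _ ⟨n, rfl⟩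
      refine (le_iff_re_inner_le (hsa n) hsS).2 fun v => ?_
      exact Monotone.ge_of_tendsto (fun m n h => re_inner_mono (hj h) v) (tendsto_re_inner hs v) n
    · refine (le_iff_re_inner_le hsS t.2).2 fun v => ?_
      exact le_of_tendsto' (tendsto_re_inner hs v) fun n => re_inner_mono (ht ⟨n, rfl⟩ : j' n ≤ t) v
  exact hA.monotoneSeqClosed j' (fun m n h => hj h) hjA ⟨_, hlub.1⟩ _ hlub

/-! ### Cyclic projections and separating vectors. -/

theorem mem_centralizer_star {A : NonUnitalStarSubalgebra ℂ (H →L[ℂ] H)} {t : H →L[ℂ] H}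
    (ht : t ∈ Set.centralizer (A : Set (H →L[ℂ] H))) :
    star t ∈ Set.centralizer (A : Set (H →L[ℂ] H)) := by
  rw [Set.mem_centralizer_iff] at ht ⊢
  intro a ha
  have := congrArg star (ht (star a) (star_mem (S := NonUnitalStarSubalgebra ℂ _) ha))
  simpa using this.symm

/-- The closed cyclic subspace generated by a vector under the commutant of `M`. -/
noncomputable def commutantCyclic (M : NonUnitalStarSubalgebra ℂ (H →L[ℂ] H)) (ξ : H) :
    Submodule ℂ H :=
  (Submodule.map (ContinuousLinearMap.apply ℂ H ξ).toLinearMap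
    (Subalgebra.toSubmodule (Subalgebra.centralizer ℂ (M : Set (H →L[ℂ] H))))).topologicalClosure

instance (M : NonUnitalStarSubalgebra ℂ (H →L[ℂ] H)) (ξ : H) :
    CompleteSpace (M.commutantCyclic ξ) :=
  (Submodule.isClosed_topologicalClosure _).completeSpace_coe

theorem apply_mem_commutantCyclic (M : NonUnitalStarSubalgebra ℂ (H →L[ℂ] H)) (ξ : H)
    {t : H →L[ℂ] H} (ht : t ∈ Set.centralizer (M : Set (H →L[ℂ] H))) :
    t ξ ∈ M.commutantCyclic ξ :=
  Submodule.le_topologicalClosure _ ⟨t, ht, rfl⟩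

theorem self_mem_commutantCyclic (M : NonUnitalStarSubalgebra ℂ (H →L[ℂ] H)) (ξ : H) :
    ξ ∈ M.commutantCyclic ξ :=
  M.apply_mem_commutantCyclic ξ (t := 1) Set.one_mem_centralizer

theorem commutantCyclic_le {M : NonUnitalStarSubalgebra ℂ (H →L[ℂ] H)} {ξ : H}
    {K : Submodule ℂ H} (hK : IsClosed (K : Set H))
    (h : ∀ t ∈ Set.centralizer (M : Set (H →L[ℂ] H)), t ξ ∈ K) : M.commutantCyclic ξ ≤ K := by
  refine Submodule.topologicalClosure_minimal _ ?_ hK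
  rintro _ ⟨t, ht, rfl⟩
  exact h t ht

theorem apply_mem_commutantCyclic_of_mem {M : NonUnitalStarSubalgebra ℂ (H →L[ℂ] H)} {ξ : H}
    {t : H →L[ℂ] H} (ht : t ∈ Set.centralizer (M : Set (H →L[ℂ] H))) :
    ∀ v ∈ M.commutantCyclic ξ, t v ∈ M.commutantCyclic ξ := by
  refine commutantCyclic_le (K := (M.commutantCyclic ξ).comap t.toLinearMap)
    ((Submodule.isClosed_topologicalClosure _).preimage t.continuous) fun s hs => ?_
  exact M.apply_mem_commutantCyclic ξ (t := t * s) (Set.mul_mem_centralizer ht hs)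

/-- A projection whose range and orthogonal complement are invariant under the commutant lies in
the double commutant. -/
theorem starProjection_mem_centralizer_centralizer
    {A : NonUnitalStarSubalgebra ℂ (H →L[ℂ] H)} (K : Submodule ℂ H) [K.HasOrthogonalProjection]
    (h : ∀ t ∈ Set.centralizer (A : Set (H →L[ℂ] H)), ∀ v ∈ K, t v ∈ K) :
    K.starProjection ∈ Set.centralizer (Set.centralizer (A : Set (H →L[ℂ] H))) := by
  rw [Set.mem_centralizer_iff]
  intro t ht
  exact commute_starProjection_of_invariant K (S := star t)
    (fun u v => (inner_apply_star_right t u v).symm) (h t ht) (h _ (mem_centralizer_star ht))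

/-- A σ-finite von Neumann algebra has a countable separating set of vectors. -/
theorem IsSigmaFinite.exists_countable_separating {M : NonUnitalStarSubalgebra ℂ (H →L[ℂ] H)}
    (hM : M.IsVonNeumannAlgebra) (hσ : M.IsSigmaFinite) :
    ∃ S : Set H, S.Countable ∧ ∀ x ∈ M, (∀ ξ ∈ S, x ξ = 0) → x = 0 := by
  obtain ⟨e, he, hep, hMe⟩ := hM
  -- The cyclic projections of such a family are nonzero, mutually orthogonal and in `M`, so
  -- σ-finiteness makes the family countable. A maximal one is separating.
  let 𝒮 : Set (Set H) := {S | (∀ ξ ∈ S, ξ ≠ 0 ∧ e ξ = ξ) ∧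
    S.Pairwise fun ξ η => M.commutantCyclic ξ ⟂ M.commutantCyclic η}
  obtain ⟨S, hS⟩ : ∃ S, Maximal (· ∈ 𝒮) S := by
    refine zorn_subset 𝒮 fun c hc hchain => ⟨⋃₀ c, ⟨?_, ?_⟩, fun s hs => Set.subset_sUnion_of_mem hs⟩
    · rintro ξ ⟨s, hs, hξ⟩
      exact (hc hs).1 ξ hξ
    · exact (Set.pairwise_sUnion hchain.directedOn).2 fun s hs => (hc hs).2
  have hnz : ∀ ξ ∈ S, (M.commutantCyclic ξ).starProjection ≠ 0 := by
    intro ξ hξ h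
    have := Submodule.starProjection_eq_self_iff.2 (M.self_mem_commutantCyclic ξ)
    rw [h] at this
    exact (hS.1.1 ξ hξ).1 this.symm
  have horth : S.Pairwise fun ξ η => (M.commutantCyclic ξ).starProjection *
      (M.commutantCyclic η).starProjection = 0 := fun ξ hξ η hη hne =>
    (hS.1.2 hξ hη hne).starProjection_comp_starProjection
  refine ⟨S, ?_, fun x hx hxS => ?_⟩
  · have hinj : Set.InjOn (fun ξ => (M.commutantCyclic ξ).starProjection) S := by
      intro ξ hξ η hη h
      by_contra hne
      have h1 : (M.commutantCyclic ξ).starProjection * (M.commutantCyclic η).starProjection = 0 :=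
        horth hξ hη hne
      simp only at h
      rw [← h, (Submodule.isIdempotentElem_starProjection _).eq] at h1
      exact hnz ξ hξ h1
    refine Set.countable_of_injective_of_countable_image hinj (hσ _ ?_ ?_)
    · rintro _ ⟨ξ, hξ, rfl⟩
      have hle : ∀ v ∈ M.commutantCyclic ξ, e v = v := by
        have hK : M.commutantCyclic ξ ≤ (e - 1).ker := ?_
        · exact fun v hv => sub_eq_zero.1 (hK hv)
        refine commutantCyclic_le (e - 1).isClosed_ker fun t ht => ?_
        have := congrArg (fun T : H →L[ℂ] H => T ξ) (Set.mem_centralizer_iff.1 ht e he)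
        simp only [mul_apply_eq_comp, (hS.1.1 ξ hξ).2] at this
        simp [this]
      have h1 : e * (M.commutantCyclic ξ).starProjection = (M.commutantCyclic ξ).starProjection := by
        ext v
        exact hle _ (Submodule.starProjection_apply_mem _ _)
      refine ⟨(hMe _).2 ⟨starProjection_mem_centralizer_centralizer _ fun t ht =>
        apply_mem_commutantCyclic_of_mem ht, h1, ?_⟩,
        isStarProjection_starProjection, hnz ξ hξ⟩
      have := congrArg star h1
      rwa [star_mul, hep.isSelfAdjoint.star_eq, (isSelfAdjoint_starProjection _).star_eq] at this
    · rintro _ ⟨ξ, hξ, rfl⟩ _ ⟨η, hη, rfl⟩ hne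
      exact horth hξ hη fun h => hne (by rw [h])
  -- A nonzero `x* v` could be added to `S`: for `s`, `t` in the commutant, `⟪t x* v, s η⟫ = ⟪v, t*
  -- s x η⟫ = 0`.
  · have hstar : star x = 0 := by
      ext v
      by_contra hv
      have hx' : e * star x = star x := by
        have := congrArg star ((hMe x).1 hx).2.2
        rwa [star_mul, hep.isSelfAdjoint.star_eq] at this
      have hortho : ∀ η ∈ S, M.commutantCyclic (star x v) ⟂ M.commutantCyclic η := by
        intro η hη
        refine commutantCyclic_le (Submodule.isClosed_orthogonal _) fun t ht => ?_
        rw [Submodule.mem_orthogonal']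
        have : M.commutantCyclic η ≤ (ℂ ∙ (t (star x v)))ᗮ := by
          refine commutantCyclic_le (Submodule.isClosed_orthogonal _) fun s hs => ?_
          rw [Submodule.mem_orthogonal_singleton_iff_inner_right, ← inner_apply_star_right,
            inner_apply_star_left]
          have h1 := congrArg (fun T : H →L[ℂ] H => T η) (Set.mem_centralizer_iff.1
            (Set.mul_mem_centralizer (mem_centralizer_star ht) hs) x hx)
          simp only [mul_apply_eq_comp, hxS η hη, map_zero] at h1
          rw [h1, inner_zero_right]
        intro u hu
        exact Submodule.mem_orthogonal_singleton_iff_inner_right.1 (this hu)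
      have hins : insert (star x v) S ∈ 𝒮 := by
        refine ⟨?_, ?_⟩
        · rintro ξ (rfl | hξ)
          · exact ⟨hv, congrArg (fun T : H →L[ℂ] H => T v) hx'⟩
          · exact hS.1.1 ξ hξ
        · refine hS.1.2.insert fun η hη _ => ⟨hortho η hη, (hortho η hη).symm⟩
      have hmem : star x v ∈ S := hS.2 hins (Set.subset_insert _ _) (Set.mem_insert _ _)
      have := hortho _ hmem
      rw [Submodule.isOrtho_self] at this
      have h2 := M.self_mem_commutantCyclic (star x v)
      rw [this] at h2
      exact hv h2
    exact star_eq_zero.1 hstar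

end NonUnitalStarSubalgebra

/-! ### The transform `T (1 + T)⁻¹`. -/

namespace NonUnitalStarSubalgebra

open scoped InnerProductSpace
open Filter Topology

variable {H : Type*} [NormedAddCommGroup H] [InnerProductSpace ℂ H] [CompleteSpace H]

/-- The operator `1 - (1 + T)⁻¹ = T (1 + T)⁻¹` for positive `T`. -/
noncomputable def resolventCut (T : H →L[ℂ] H) : H →L[ℂ] H :=
  cfcₙ (fun x : ℝ => 1 - (1 + x)⁻¹) T

theorem continuousOn_one_sub_one_add_inv :
    ContinuousOn (fun x : ℝ => 1 - (1 + x)⁻¹) (Set.Ici 0) :=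
  continuousOn_const.sub ((continuousOn_const.add continuousOn_id).inv₀ fun x hx => by
    have : (0 : ℝ) ≤ x := hx
    change 1 + x ≠ 0
    positivity)

theorem quasispectrum_subset_Ici {T : H →L[ℂ] H} (hT : 0 ≤ T) :
    quasispectrum ℝ T ⊆ Set.Ici 0 := fun _ hx => quasispectrum_nonneg_of_nonneg T hT _ hx

theorem one_sub_one_add_inv_nonneg {x : ℝ} (hx : 0 ≤ x) : 0 ≤ 1 - (1 + x)⁻¹ :=
  sub_nonneg.2 (inv_le_one_of_one_le₀ (by linarith))

theorem resolventCut_nonneg {T : H →L[ℂ] H} (hT : 0 ≤ T) : 0 ≤ resolventCut T :=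
  cfcₙ_nonneg fun _ hx => one_sub_one_add_inv_nonneg (quasispectrum_subset_Ici hT hx)

theorem resolventCut_mono {S T : H →L[ℂ] H} (hS : 0 ≤ S) (h : S ≤ T) :
    resolventCut S ≤ resolventCut T :=
  CFC.monotoneOn_one_sub_one_add_inv_real hS (hS.trans h) h

theorem resolventCut_le_self {T : H →L[ℂ] H} (hT : 0 ≤ T) : resolventCut T ≤ T := by
  have hsub := quasispectrum_subset_Ici hT
  conv_rhs => rw [← cfcₙ_id ℝ T (IsSelfAdjoint.of_nonneg hT)]
  refine cfcₙ_mono (fun x hx => ?_) (continuousOn_one_sub_one_add_inv.mono hsub)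
  have hx : 0 ≤ x := hsub hx
  have h1 : (0 : ℝ) < 1 + x := by linarith
  simp only [id]
  rw [show 1 - (1 + x)⁻¹ = x / (1 + x) by field_simp; ring]
  exact div_le_self hx (by linarith)

theorem resolventCut_add_mul {T : H →L[ℂ] H} (hT : 0 ≤ T) :
    resolventCut T + T * resolventCut T = T := by
  have hsub := quasispectrum_subset_Ici hT
  have hc := continuousOn_one_sub_one_add_inv.mono hsub
  have hsa := IsSelfAdjoint.of_nonneg hT
  have hc' : ContinuousOn (fun x : ℝ => id x * (1 - (1 + x)⁻¹)) (quasispectrum ℝ T) :=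
    continuousOn_id.mul hc
  conv_lhs => rw [resolventCut]; arg 2; arg 1; rw [← cfcₙ_id ℝ T hsa]
  conv_rhs => rw [← cfcₙ_id ℝ T hsa]
  rw [← cfcₙ_mul (hf := continuousOn_id) (hg := hc),
    ← cfcₙ_add (hf := hc) (hg := hc')]
  refine cfcₙ_congr fun x hx => ?_
  have hx : 0 ≤ x := hsub hx
  have h1 : (0 : ℝ) < 1 + x := by linarith
  simp only [id]
  field_simp
  ring

theorem resolventCut_le_one {T : H →L[ℂ] H} (hT : 0 ≤ T) : resolventCut T ≤ 1 := by
  have hsub := quasispectrum_subset_Ici hT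
  rw [resolventCut, cfcₙ_eq_cfc (hf := continuousOn_one_sub_one_add_inv.mono hsub)]
  refine cfc_le_one _ _ fun x hx => ?_
  have hx : 0 ≤ x := hsub (spectrum_subset_quasispectrum ℝ T hx)
  have : 0 ≤ (1 + x)⁻¹ := by positivity
  linarith

/-- The function vanishes at `0`, so the non-unital calculus applies and no identity in `A` is
needed. -/
theorem resolventCut_mem {A : NonUnitalStarSubalgebra ℂ (H →L[ℂ] H)}
    (hA : IsClosed (A : Set (H →L[ℂ] H))) {T : H →L[ℂ] H} (hT : T ∈ A) : resolventCut T ∈ A :=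
  have : IsClosed (A : Set (H →L[ℂ] H)) := hA
  cfcₙ_mem (𝕜 := ℝ) (𝕜' := ℂ) _ hT

/-- If `ξ` is close to `δ c* ξ` with `δ` small, then `(1 + c* c)⁻¹` is small at `ξ`. -/
theorem re_inner_one_sub_resolventCut_le (c : H →L[ℂ] H) (ξ : H) {δ : ℝ} (hδ : 0 ≤ δ) :
    (⟪(1 - resolventCut (star c * c)) ξ, ξ⟫_ℂ).re
      ≤ ‖ξ‖ * ‖ξ - (δ : ℂ) • star c ξ‖ + δ * ‖ξ‖ ^ 2 := by
  -- Here `w = (1 + c* c)⁻¹ ξ`. Both `‖w‖` and `‖c w‖` are at most `‖ξ‖`, whatever the size of `c`.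
  set w := (1 - resolventCut (star c * c)) ξ with hw
  have hT : 0 ≤ star c * c := star_mul_self_nonneg c
  have hξ : w + star c (c w) = ξ := by
    have h := congrArg (fun T : H →L[ℂ] H => T ξ) (resolventCut_add_mul hT)
    simp only [add_apply, mul_apply_eq_comp] at h
    simp only [hw, sub_apply, one_apply_eq_self, map_sub]
    rw [← h]
    abel_nf
  have ht : (⟪w, ξ⟫_ℂ).re = ‖w‖ ^ 2 + ‖c w‖ ^ 2 := by
    conv_lhs => rw [← hξ]
    rw [inner_add_right, inner_apply_star_right, Complex.add_re]
    congr 1 <;> exact inner_self_eq_norm_sq (𝕜 := ℂ) _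
  have hcs : (⟪w, ξ⟫_ℂ).re ≤ ‖w‖ * ‖ξ‖ := re_inner_le_norm (𝕜 := ℂ) w ξ
  have hwξ : ‖w‖ ≤ ‖ξ‖ := by
    by_contra! h
    nlinarith [norm_nonneg w, norm_nonneg ξ, sq_nonneg ‖c w‖]
  have hcw : ‖c w‖ ≤ ‖ξ‖ := by
    refine le_of_sq_le_sq ?_ (norm_nonneg _)
    nlinarith [norm_nonneg w, norm_nonneg ξ, sq_nonneg ‖w‖]
  -- Split `ξ` as `(ξ - δ c* ξ) + δ c* ξ` and move `c*` onto `w`.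
  have hsplit : (⟪w, ξ⟫_ℂ).re
      = (⟪w, ξ - (δ : ℂ) • star c ξ⟫_ℂ).re + δ * (⟪c w, ξ⟫_ℂ).re := by
    rw [inner_sub_right, inner_smul_right, inner_apply_star_right, Complex.sub_re,
      Complex.re_ofReal_mul]
    ring
  rw [hsplit]
  have h1 : (⟪w, ξ - (δ : ℂ) • star c ξ⟫_ℂ).re ≤ ‖w‖ * ‖ξ - (δ : ℂ) • star c ξ‖ :=
    re_inner_le_norm (𝕜 := ℂ) _ _
  have h2 : (⟪c w, ξ⟫_ℂ).re ≤ ‖c w‖ * ‖ξ‖ := re_inner_le_norm (𝕜 := ℂ) _ _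
  refine add_le_add (h1.trans (by gcongr)) ?_
  rw [pow_two]
  exact mul_le_mul_of_nonneg_left (h2.trans (by gcongr)) hδ

end NonUnitalStarSubalgebra

/-! ### Projections in a Borel *-algebra. -/

namespace NonUnitalStarSubalgebra

open scoped InnerProductSpace
open Filter Topology

variable {H : Type*} [NormedAddCommGroup H] [InnerProductSpace ℂ H] [CompleteSpace H]

/-- From elements of a Borel *-algebra that approximate a projection fast enough on a sequence of
vectors one obtains an element that agrees with the projection on these vectors. -/
theorem IsBorelStarAlgebra.exists_mem_apply_eq {A : NonUnitalStarSubalgebra ℂ (H →L[ℂ] H)}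
    (hA : A.IsBorelStarAlgebra) {c : ℕ → H →L[ℂ] H} (hcA : ∀ k, c k ∈ A) (η ζ : ℕ → H)
    (hη : ∀ i k, i ≤ k → ‖c k (η i)‖ ≤ (1 / 2 : ℝ) ^ k)
    (hζ : ∀ i k, i ≤ k → ‖ζ i - (((1 / 2 : ℝ) ^ k : ℝ) : ℂ) • star (c k) (ζ i)‖
      ≤ (1 / 2 : ℝ) ^ k) :
    ∃ y ∈ A, ∀ i, y (η i) = 0 ∧ y (ζ i) = ζ i := by
  let T : ℕ → ℕ → H →L[ℂ] H := fun n m => ∑ k ∈ Finset.Ico n m, star (c k) * c k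
  have hTA : ∀ n m, T n m ∈ A := fun n m =>
    sum_mem fun k _ => mul_mem (star_mem (hcA k)) (hcA k)
  have hT0 : ∀ n m, 0 ≤ T n m := fun n m => Finset.sum_nonneg fun k _ => star_mul_self_nonneg _
  have hTsub : ∀ {n m n' m'}, Finset.Ico n m ⊆ Finset.Ico n' m' → T n m ≤ T n' m' := fun h =>
    Finset.sum_le_sum_of_subset_of_nonneg h fun k _ _ => star_mul_self_nonneg _
  let Y : ℕ → ℕ → H →L[ℂ] H := fun n m => resolventCut (T n m)
  have hY0 : ∀ n m, 0 ≤ Y n m := fun n m => resolventCut_nonneg (hT0 n m)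
  have hY1 : ∀ n m, Y n m ≤ 1 := fun n m => resolventCut_le_one (hT0 n m)
  have hYsa : ∀ n m, IsSelfAdjoint (Y n m) := fun n m => .of_nonneg (hY0 n m)
  have hYmono : ∀ n, Monotone (Y n) := fun n m m' h =>
    resolventCut_mono (hT0 _ _) (hTsub (Finset.Ico_subset_Ico_right h))
  choose y hy using fun n => exists_tendsto_of_monotone (hYmono n) (hY0 n) (hY1 n)
  have hyA : ∀ n, y n ∈ A := fun n => hA.mem_of_monotone_of_tendsto (hYmono n)
    (fun m => resolventCut_mem hA.isClosed (hTA n m)) (hYsa n) (hy n)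
  have hy0 : ∀ n, 0 ≤ y n := fun n => le_of_tendsto_apply (fun _ => .zero _) (hYsa n)
    (fun _ => tendsto_const_nhds) (hy n) (hY0 n)
  have hy1 : ∀ n, y n ≤ 1 := fun n => le_of_tendsto_apply (hYsa n) (fun _ => .one _)
    (hy n) (fun _ => tendsto_const_nhds) (hY1 n)
  have hysa : ∀ n, IsSelfAdjoint (y n) := fun n => .of_nonneg (hy0 n)
  have hYy : ∀ n m, Y n m ≤ y n := fun n m => (le_iff_re_inner_le (hYsa n m) (hysa n)).2 fun v =>
    Monotone.ge_of_tendsto (fun m n' h => re_inner_mono (hYmono n h) v) (tendsto_re_inner (hy n) v) m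
  have hyanti : Antitone y := fun n n' h => le_of_tendsto_apply (hYsa n') (hYsa n) (hy n') (hy n)
    fun m => resolventCut_mono (hT0 _ _) (hTsub (Finset.Ico_subset_Ico_left h))
  obtain ⟨s, hs⟩ := exists_tendsto_of_monotone (j := fun n => 1 - y n)
    (fun m n h => sub_le_sub_left (hyanti h) 1) (fun n => sub_nonneg.2 (hy1 n))
    (fun n => sub_le_self _ (hy0 n))
  have hlim : ∀ v, Tendsto (fun n => y n v) atTop (𝓝 ((1 - s) v)) := fun v => by
    simpa using (tendsto_const_nhds (x := v)).sub (hs v)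
  have hmem : 1 - s ∈ A := by
    -- The increasing sequence used here is `-y n`, since `1 - y n` need not lie in `A`.
    rw [← neg_mem_iff]
    refine hA.mem_of_monotone_of_tendsto (j := fun n => -y n) (fun m n h => neg_le_neg (hyanti h))
      (fun n => neg_mem (hyA n)) (fun n => (hysa n).neg) fun v => ?_
    simpa using (hlim v).neg
  have h0 : 0 ≤ 1 - s := le_of_tendsto_apply (fun _ => .zero _) hysa
    (fun _ => tendsto_const_nhds) hlim hy0
  have h1 : 1 - s ≤ 1 := le_of_tendsto_apply hysa (fun _ => .one _)
    hlim (fun _ => tendsto_const_nhds) hy1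
  have hpow : Tendsto (fun k : ℕ => (1 / 2 : ℝ) ^ k) atTop (𝓝 0) :=
    tendsto_pow_atTop_nhds_zero_of_lt_one (by norm_num) (by norm_num)
  refine ⟨1 - s, hmem, fun i => ⟨?_, ?_⟩⟩
  -- The form of `y n` at `η i` is bounded by the tail of a convergent series, so it tends to zero.
  · have hbound : ∀ n, i ≤ n → (⟪y n (η i), η i⟫_ℂ).re ≤ (1 / 2 : ℝ) ^ n / (1 - 1 / 2) := by
      intro n hn
      refine le_of_tendsto' (tendsto_re_inner (hy n) (η i)) fun m => ?_
      calc (⟪Y n m (η i), η i⟫_ℂ).re ≤ (⟪T n m (η i), η i⟫_ℂ).re :=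
            re_inner_mono (resolventCut_le_self (hT0 n m)) _
        _ = ∑ k ∈ Finset.Ico n m, ‖c k (η i)‖ ^ 2 := by
            simp only [T, sum_apply, sum_inner, Complex.re_sum, mul_apply_eq_comp,
              inner_apply_star_left]
            exact Finset.sum_congr rfl fun k _ => inner_self_eq_norm_sq (𝕜 := ℂ) _
        _ ≤ ∑ k ∈ Finset.Ico n m, (1 / 2 : ℝ) ^ k := by
            refine Finset.sum_le_sum fun k hk => ?_
            have h2 := hη i k (hn.trans (Finset.mem_Ico.1 hk).1)
            have h3 : (1 / 2 : ℝ) ^ k ≤ 1 := pow_le_one₀ (by norm_num) (by norm_num)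
            nlinarith [norm_nonneg (c k (η i))]
        _ ≤ _ := geom_sum_Ico_le_of_lt_one (by norm_num) (by norm_num)
    have hle : (⟪(1 - s) (η i), η i⟫_ℂ).re ≤ 0 := by
      refine le_of_tendsto_of_tendsto (tendsto_re_inner hlim (η i))
        (hpow.div_const (1 - 1 / 2)) ?_ |>.trans_eq (zero_div _)
      filter_upwards [eventually_ge_atTop i] with n hn using hbound n hn
    have := (norm_sq_apply_le_re_inner h0 h1 (η i)).trans hle
    exact norm_eq_zero.1 (pow_eq_zero_iff two_ne_zero |>.1 (le_antisymm this (sq_nonneg _)))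
  -- Each `y n` dominates the transform of every single term `(c m)* c m` with `m ≥ n`, and these
  -- are nearly `1` at `ζ i` for large `m`.
  · have hfix : ∀ n, y n (ζ i) = ζ i := by
      intro n
      have hle : (⟪(1 - y n) (ζ i), ζ i⟫_ℂ).re ≤ 0 := by
        have hlim0 : Tendsto (fun m : ℕ => ‖ζ i‖ * (1 / 2 : ℝ) ^ m + (1 / 2 : ℝ) ^ m * ‖ζ i‖ ^ 2)
            atTop (𝓝 0) := by
          simpa using (hpow.const_mul ‖ζ i‖).add (hpow.mul_const (‖ζ i‖ ^ 2))
        refine ge_of_tendsto hlim0 ?_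
        filter_upwards [eventually_ge_atTop i, eventually_ge_atTop n] with m him hnm
        have hsingle : star (c m) * c m ≤ T n (m + 1) := by
          have := hTsub (n := m) (m := m + 1) (Finset.Ico_subset_Ico_left (b := m + 1) hnm)
          rwa [show T m (m + 1) = star (c m) * c m by simp [T]] at this
        have hres : resolventCut (star (c m) * c m) ≤ y n :=
          (resolventCut_mono (star_mul_self_nonneg (c m)) hsingle).trans (hYy n (m + 1))
        refine (re_inner_mono (sub_le_sub_left hres 1) (ζ i)).trans ?_
        refine (re_inner_one_sub_resolventCut_le (c m) (ζ i) (δ := (1 / 2 : ℝ) ^ m)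
          (by positivity)).trans ?_
        gcongr
        exact hζ i m him
      have h2 := (norm_sq_apply_le_re_inner (sub_nonneg.2 (hy1 n)) (sub_le_self _ (hy0 n))
        (ζ i)).trans hle
      have h3 := norm_eq_zero.1
        (pow_eq_zero_iff two_ne_zero |>.1 (le_antisymm h2 (sq_nonneg _)))
      exact (sub_eq_zero.1 h3).symm
    exact tendsto_nhds_unique (hlim (ζ i)) (by simp [hfix])

/-- A projection in the double commutant of a Borel *-algebra that vanishes on the common kernel
lies in the algebra if it is determined there by its values on a sequence of vectors. -/
theorem IsBorelStarAlgebra.mem_of_isStarProjection {A : NonUnitalStarSubalgebra ℂ (H →L[ℂ] H)}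
    (hA : A.IsBorelStarAlgebra) {p : H →L[ℂ] H} (hp : IsStarProjection p)
    (hpA : p ∈ Set.centralizer (Set.centralizer (A : Set (H →L[ℂ] H))))
    (hker : ∀ v, (∀ a ∈ A, a v = 0) → p v = 0) (ξ : ℕ → H)
    (hsep : ∀ y ∈ A, (∀ n, y (ξ n) = p (ξ n)) → y = p) : p ∈ A := by
  have hpp : ∀ v, p (p v) = p v := fun v =>
    congrArg (fun T : H →L[ℂ] H => T v) hp.isIdempotentElem.eq
  have hex : ∀ k : ℕ, ∃ b ∈ A, ∀ i : Fin (k + 1),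
      ‖b (ξ i - p (ξ i)) - p (ξ i - p (ξ i))‖ < (1 / 4 : ℝ) ^ k ∧
      ‖star b (p (ξ i)) - star p (p (ξ i))‖ < (1 / 4 : ℝ) ^ k := fun k =>
    exists_mem_norm_sub_lt_of_mem_centralizer_centralizer hpA hker
      (fun i : Fin (k + 1) => ξ i - p (ξ i)) (fun i => p (ξ i)) (by positivity)
  choose b hbA hb using hex
  have h2 : ∀ k : ℕ, (2 : ℝ) ^ k * (1 / 4) ^ k = (1 / 2) ^ k := fun k => by
    rw [← mul_pow]; norm_num
  have h4 : ∀ k : ℕ, (1 / 4 : ℝ) ^ k ≤ (1 / 2) ^ k := fun k => by gcongr; norm_num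
  -- The factor `2ᵏ` leaves an error `2ᵏ 4⁻ᵏ = 2⁻ᵏ` where `p` vanishes, and `δ = 2⁻ᵏ` undoes it on
  -- the range of `p`.
  obtain ⟨y, hyA, hy⟩ := hA.exists_mem_apply_eq (c := fun k => (((2 : ℝ) ^ k : ℝ) : ℂ) • b k)
    (fun k => SMulMemClass.smul_mem _ (hbA k)) (fun i => ξ i - p (ξ i)) (fun i => p (ξ i))
    (fun i k hik => by
      have h := (hb k ⟨i, Nat.lt_succ_of_le hik⟩).1.le
      simp only [map_sub, hpp, sub_self, sub_zero] at h
      rw [smul_apply, norm_smul, Complex.norm_real, Real.norm_of_nonneg (by positivity), ← h2,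
        map_sub]
      gcongr)
    (fun i k hik => by
      have h := (hb k ⟨i, Nat.lt_succ_of_le hik⟩).2.le
      simp only [hp.isSelfAdjoint.star_eq, hpp] at h
      rw [star_smul, smul_apply, smul_smul, Complex.star_def, Complex.conj_ofReal,
        ← Complex.ofReal_mul, ← mul_pow, norm_sub_rev]
      norm_num
      norm_num at h
      exact h.trans (by simpa using h4 k))
  have hyp : y = p := hsep y hyA fun n => by
    have := (hy n).1
    rw [map_sub, (hy n).2] at this
    exact sub_eq_zero.1 this
  exact hyp ▸ hyA

end NonUnitalStarSubalgebra

/-! ### From projections to the whole double commutant. -/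

namespace NonUnitalStarSubalgebra

open scoped InnerProductSpace
open Filter Topology

variable {H : Type*} [NormedAddCommGroup H] [InnerProductSpace ℂ H]

theorem smul_add_smul_mem_centralizer {S : Set (H →L[ℂ] H)} {x y : H →L[ℂ] H}
    (hx : x ∈ Set.centralizer S) (hy : y ∈ Set.centralizer S) (r s : ℂ) :
    r • x + s • y ∈ Set.centralizer S :=
  (Subalgebra.centralizer ℂ S).add_mem (Subalgebra.smul_mem _ hx r) (Subalgebra.smul_mem _ hy s)

variable [CompleteSpace H]

theorem mem_centralizer_centralizer_star {A : NonUnitalStarSubalgebra ℂ (H →L[ℂ] H)}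
    {x : H →L[ℂ] H} (hx : x ∈ Set.centralizer (Set.centralizer (A : Set (H →L[ℂ] H)))) :
    star x ∈ Set.centralizer (Set.centralizer (A : Set (H →L[ℂ] H))) :=
  Set.star_mem_centralizer' (fun _ ht => mem_centralizer_star ht) hx

/-- The spectral projection `p` of a positive contraction `x` for the interval `(1/2, 1]` gives
the first binary digit of `x`: the operator `2x - p` is again a positive contraction. -/
theorem exists_isStarProjection_two_smul_sub {A : NonUnitalStarSubalgebra ℂ (H →L[ℂ] H)}
    {x : H →L[ℂ] H} (hx : x ∈ Set.centralizer (Set.centralizer (A : Set (H →L[ℂ] H))))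
    (hker : ∀ v, (∀ a ∈ A, a v = 0) → x v = 0) (h0 : 0 ≤ x) (h1 : x ≤ 1) :
    ∃ p : H →L[ℂ] H, IsStarProjection p ∧
      p ∈ Set.centralizer (Set.centralizer (A : Set (H →L[ℂ] H))) ∧
      (∀ v, (∀ a ∈ A, a v = 0) → p v = 0) ∧ 0 ≤ (2 : ℂ) • x - p ∧ (2 : ℂ) • x - p ≤ 1 := by
  have hsa : IsSelfAdjoint x := .of_nonneg h0
  have hs0 : ∀ t ∈ spectrum ℝ x, 0 ≤ t := fun t ht => spectrum_nonneg_of_nonneg h0 ht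
  have hs1 : ∀ t ∈ spectrum ℝ x, t ≤ 1 := (CFC.le_one_iff (R := ℝ) x).1 h1
  -- `y` and `z` are the positive and negative parts of `2x - 1`; `p` will be the range projection
  -- of `y`.
  set y := cfc (fun t : ℝ => max (2 * t - 1) 0) x with hy
  set z := cfc (fun t : ℝ => max (1 - 2 * t) 0) x with hz
  have hyc : ContinuousOn (fun t : ℝ => max (2 * t - 1) 0) (spectrum ℝ x) := by fun_prop
  have hzc : ContinuousOn (fun t : ℝ => max (1 - 2 * t) 0) (spectrum ℝ x) := by fun_prop
  have hy0 : 0 ≤ y := cfc_nonneg fun t _ => le_max_right _ _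
  have hz0 : 0 ≤ z := cfc_nonneg fun t _ => le_max_right _ _
  have hy1 : y ≤ 1 := cfc_le_one _ _ fun t ht =>
    max_le (by linarith [hs1 t ht]) zero_le_one
  have hz1 : z ≤ 1 := cfc_le_one _ _ fun t ht =>
    max_le (by linarith [hs0 t ht]) zero_le_one
  have hysa : star y = y := (IsSelfAdjoint.of_nonneg hy0).star_eq
  have hzsa : star z = z := (IsSelfAdjoint.of_nonneg hz0).star_eq
  have hzy : z * y = 0 := by
    rw [hz, hy, ← cfc_mul _ _ x hzc hyc]
    refine (cfc_congr fun t _ => ?_).trans (cfc_zero ℝ x)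
    rcases le_total (2 * t) 1 with h | h
    · simp [max_eq_right (show 2 * t - 1 ≤ 0 by linarith)]
    · simp [max_eq_right (show 1 - 2 * t ≤ 0 by linarith)]
  have hyz : y - z = (2 : ℂ) • x - 1 := by
    rw [hz, hy, ← cfc_sub _ _ x hyc hzc]
    have : (2 : ℂ) • x - 1 = cfc (fun t : ℝ => 2 * t - 1) x := by
      rw [cfc_sub _ _ x (by fun_prop) (by fun_prop), cfc_const_mul _ _ x (by fun_prop),
        cfc_id' ℝ x, cfc_const_one ℝ x, ofNat_smul_eq_nsmul ℂ, ofNat_smul_eq_nsmul ℝ]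
    rw [this]
    refine cfc_congr fun t _ => ?_
    rcases le_total (2 * t) 1 with h | h
    · simp only [max_eq_right (show 2 * t - 1 ≤ 0 by linarith),
        max_eq_left (show 0 ≤ 1 - 2 * t by linarith)]
      ring
    · simp only [max_eq_right (show 1 - 2 * t ≤ 0 by linarith),
        max_eq_left (show 0 ≤ 2 * t - 1 by linarith)]
      ring
  have hyker : ∀ v, x v = 0 → y v = 0 := by
    -- The numerator vanishes for `t ≤ 1/2`, so any cutoff in `(0, 1/2]` makes the quotient
    -- continuous without changing its product with `t`.
    have hgc : ContinuousOn (fun t : ℝ => max (2 * t - 1) 0 / max t (1 / 4)) (spectrum ℝ x) := by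
      refine ContinuousOn.div (by fun_prop) (by fun_prop) fun t _ => ?_
      have : (0 : ℝ) < max t (1 / 4) := lt_max_of_lt_right (by norm_num)
      exact this.ne'
    have : y = cfc (fun t : ℝ => max (2 * t - 1) 0 / max t (1 / 4)) x * x := by
      conv_rhs => arg 2; rw [← cfc_id' ℝ x]
      rw [← cfc_mul _ _ x hgc (continuousOn_id' _)]
      refine cfc_congr fun t _ => ?_
      rcases le_total (2 * t) 1 with h | h
      · simp [max_eq_right (show 2 * t - 1 ≤ 0 by linarith)]
      · have ht : t ≠ 0 := by linarith
        simp only [max_eq_left (show 1 / 4 ≤ t by linarith)]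
        field_simp
    intro v hv
    rw [this, mul_apply_eq_comp, hv, map_zero]
  let K : Submodule ℂ H := y.range.topologicalClosure
  have hKc : IsClosed (K : Set H) := Submodule.isClosed_topologicalClosure _
  have : CompleteSpace K := hKc.completeSpace_coe
  have hKmin : ∀ {L : Submodule ℂ H}, IsClosed (L : Set H) → (∀ v, y v ∈ L) → K ≤ L := by
    intro L hL h
    refine Submodule.topologicalClosure_minimal _ ?_ hL
    rintro _ ⟨v, rfl⟩
    exact h v
  have hyK : ∀ v, y v ∈ K := fun v => Submodule.le_topologicalClosure _ ⟨v, rfl⟩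
  set p := K.starProjection with hp
  have hpsa : star p = p := (isSelfAdjoint_starProjection K).star_eq
  have hpp : p * p = p := K.isIdempotentElem_starProjection.eq
  have hpy : p * y = y := by
    ext v
    exact Submodule.starProjection_eq_self_iff.2 (hyK v)
  have hyp : y * p = y := by
    have := congrArg star hpy
    rwa [star_mul, hpsa, hysa] at this
  have hzp : z * p = 0 := by
    ext v
    have hle : K ≤ z.ker := hKmin z.isClosed_ker fun v =>
      congrArg (fun T : H →L[ℂ] H => T v) hzy
    exact hle (K.starProjection_apply_mem v)
  have hpz : p * z = 0 := by
    have := congrArg star hzp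
    rwa [star_mul, hpsa, hzsa, star_zero] at this
  have hx2 : (2 : ℂ) • x = 1 + y - z := by
    rw [add_sub_assoc, hyz]
    abel
  refine ⟨p, isStarProjection_starProjection, starProjection_mem_centralizer_centralizer K ?_,
    ?_, ?_, ?_⟩
  · intro t ht
    have hxt : Commute x t := (Set.mem_centralizer_iff.1 hx t ht).symm
    have hyt : y * t = t * y := (hxt.cfc_real _).eq
    refine hKmin (L := K.comap t.toLinearMap) (hKc.preimage t.continuous) fun v => ?_
    have := congrArg (fun T : H →L[ℂ] H => T v) hyt
    change t (y v) ∈ K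
    simp only [mul_apply_eq_comp] at this
    rw [← this]
    exact hyK _
  · intro v hv
    rw [hp, Submodule.starProjection_apply_eq_zero_iff, Submodule.mem_orthogonal']
    have hle : K ≤ (ℂ ∙ v)ᗮ := hKmin (Submodule.isClosed_orthogonal _) fun u => by
      rw [Submodule.mem_orthogonal_singleton_iff_inner_right, ← hysa, inner_apply_star_right,
        hyker v (hker v hv), inner_zero_left]
    exact fun u hu => Submodule.mem_orthogonal_singleton_iff_inner_right.1 (hle hu)
  -- `2x - p = (1 - p)(1 - z)(1 - p) + y`.
  · have h := star_left_conjugate_nonneg (sub_nonneg.2 hz1) (1 - p)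
    have heq : star (1 - p) * (1 - z) * (1 - p) = 1 - p - z := by
      rw [star_sub, star_one, hpsa]
      simp only [sub_mul, mul_sub, one_mul, mul_one, hpp, hzp, hpz, zero_mul]
      abel
    rw [heq] at h
    have := add_nonneg h hy0
    rw [hx2]
    convert this using 1
    abel
  -- `1 - (2x - p) = p (1 - y) p + z`.
  · have h := star_left_conjugate_nonneg (sub_nonneg.2 hy1) p
    have heq : star p * (1 - y) * p = p - y := by
      rw [hpsa]
      simp only [sub_mul, mul_sub, mul_one, hpp, hyp, hpy]
    rw [heq] at h
    have := add_nonneg h hz0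
    rw [hx2, ← sub_nonneg]
    convert this using 1
    abel

/-- Binary expansion: a norm-closed *-algebra that contains the projections of its double
commutant that vanish on its common kernel contains the positive contractions with these
properties. -/
theorem mem_of_nonneg_of_le_one {A : NonUnitalStarSubalgebra ℂ (H →L[ℂ] H)}
    (hA : IsClosed (A : Set (H →L[ℂ] H)))
    (hproj : ∀ p : H →L[ℂ] H, IsStarProjection p →
      p ∈ Set.centralizer (Set.centralizer (A : Set (H →L[ℂ] H))) →
      (∀ v, (∀ a ∈ A, a v = 0) → p v = 0) → p ∈ A)
    {x : H →L[ℂ] H} (hx : x ∈ Set.centralizer (Set.centralizer (A : Set (H →L[ℂ] H))))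
    (hker : ∀ v, (∀ a ∈ A, a v = 0) → x v = 0) (h0 : 0 ≤ x) (h1 : x ≤ 1) : x ∈ A := by
  have happrox : ∀ n : ℕ, ∃ a ∈ A, ‖x - a‖ ≤ (1 / 2 : ℝ) ^ n := by
    intro n
    induction n generalizing x with
    | zero =>
      refine ⟨0, zero_mem _, ?_⟩
      simpa using (CStarAlgebra.norm_le_one_iff_of_nonneg x h0).2 h1
    | succ n ih =>
      obtain ⟨p, hp, hpA, hpker, h0', h1'⟩ := exists_isStarProjection_two_smul_sub hx hker h0 h1
      obtain ⟨a, ha, hxa⟩ := ih (x := (2 : ℂ) • x - p)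
        (by simpa [sub_eq_add_neg] using smul_add_smul_mem_centralizer hx hpA 2 (-1))
        (fun v hv => by simp [hker v hv, hpker v hv]) h0' h1'
      refine ⟨(1 / 2 : ℂ) • (p + a), SMulMemClass.smul_mem _ (add_mem (hproj p hp hpA hpker) ha), ?_⟩
      have : x - (1 / 2 : ℂ) • (p + a) = (1 / 2 : ℂ) • ((2 : ℂ) • x - p - a) := by
        module
      rw [this, norm_smul, pow_succ']
      have h2 : ‖(1 / 2 : ℂ)‖ = 1 / 2 := by norm_num
      rw [h2]
      gcongr
  rw [← SetLike.mem_coe, ← hA.closure_eq, Metric.mem_closure_iff]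
  intro ε hε
  obtain ⟨n, hn⟩ := exists_pow_lt_of_lt_one hε (show (1 / 2 : ℝ) < 1 by norm_num)
  obtain ⟨a, ha, hxa⟩ := happrox n
  exact ⟨a, ha, by rw [dist_eq_norm]; exact hxa.trans_lt hn⟩

/-- A norm-closed *-algebra that contains the projections of its double commutant that vanish on
its common kernel is a von Neumann algebra. -/
theorem isVonNeumannAlgebra_of_isStarProjection_mem {A : NonUnitalStarSubalgebra ℂ (H →L[ℂ] H)}
    (hA : IsClosed (A : Set (H →L[ℂ] H)))
    (hproj : ∀ p : H →L[ℂ] H, IsStarProjection p →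
      p ∈ Set.centralizer (Set.centralizer (A : Set (H →L[ℂ] H))) →
      (∀ v, (∀ a ∈ A, a v = 0) → p v = 0) → p ∈ A) :
    A.IsVonNeumannAlgebra := by
  let N : Submodule ℂ H := ⨅ a ∈ A, a.ker
  have hN : ∀ v, v ∈ N ↔ ∀ a ∈ A, a v = 0 := fun v => by simp [N]
  have hNc : IsClosed (N : Set H) := by
    have : (N : Set H) = ⋂ a ∈ A, (a.ker : Set H) := by simp [N]
    rw [this]
    exact isClosed_biInter fun a _ => a.isClosed_ker
  have : CompleteSpace N := hNc.completeSpace_coe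
  set e := Nᗮ.starProjection with he
  have hep : IsStarProjection e := isStarProjection_starProjection
  have heker : ∀ v, (∀ a ∈ A, a v = 0) → e v = 0 := fun v hv => by
    rw [he, Submodule.starProjection_apply_eq_zero_iff, Submodule.orthogonal_orthogonal]
    exact (hN v).2 hv
  have hsub : ∀ v, ∀ a ∈ A, a (v - e v) = 0 := fun v => by
    have h := Submodule.sub_starProjection_mem_orthogonal (K := Nᗮ) v
    rw [Submodule.orthogonal_orthogonal] at h
    exact (hN _).1 h
  have heA : e ∈ A := by
    refine hproj e hep (starProjection_mem_centralizer_centralizer _ fun t ht v hv => ?_) heker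
    rw [Submodule.mem_orthogonal] at hv ⊢
    intro u hu
    rw [← inner_apply_star_left]
    refine hv _ ((hN _).2 fun a ha => ?_)
    have := congrArg (fun T : H →L[ℂ] H => T u)
      (Set.mem_centralizer_iff.1 (mem_centralizer_star ht) a ha)
    simp only [mul_apply_eq_comp] at this
    rw [this, (hN u).1 hu a ha, map_zero]
  have hAe : ∀ a ∈ A, a * e = a := fun a ha => by
    ext v
    have := hsub v a ha
    rw [map_sub, sub_eq_zero] at this
    exact this.symm
  -- Compression by `e` gives `-r e ≤ z ≤ r e`, so `(r e + z) / (2r)` is a positive contraction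
  -- vanishing on the common kernel.
  have hsa : ∀ z : H →L[ℂ] H, IsSelfAdjoint z →
      z ∈ Set.centralizer (Set.centralizer (A : Set (H →L[ℂ] H))) → z * e = z → z ∈ A := by
    intro z hz hzA hze
    have hez : e * z = z := by
      have := congrArg star hze
      rwa [star_mul, hz.star_eq, hep.isSelfAdjoint.star_eq] at this
    have hconj : star e * z * e = z := by rw [hep.isSelfAdjoint.star_eq, hez, hze]
    obtain ⟨r, hr, hzr⟩ : ∃ r : ℝ, 0 < r ∧ ‖z‖ ≤ r := ⟨‖z‖ + 1, by positivity, by linarith⟩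
    have hone : star e * algebraMap ℝ (H →L[ℂ] H) ‖z‖ * e = ‖z‖ • e := by
      rw [Algebra.algebraMap_eq_smul_one, hep.isSelfAdjoint.star_eq, mul_smul_comm, mul_one,
        smul_mul_assoc, hep.isIdempotentElem.eq]
    have he0 : 0 ≤ e := hep.nonneg
    have he1 : e ≤ 1 := hep.le_one
    have hup : z ≤ r • e := by
      have := star_left_conjugate_le_conjugate hz.le_algebraMap_norm_self e
      rw [hconj, hone] at this
      exact this.trans (smul_le_smul_of_nonneg_right hzr he0)
    have hlow : -(r • e) ≤ z := by
      have := star_left_conjugate_le_conjugate hz.neg_algebraMap_norm_le_self e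
      rw [hconj, mul_neg, neg_mul, hone] at this
      exact (neg_le_neg (smul_le_smul_of_nonneg_right hzr he0)).trans this
    have hw : ((2 * r)⁻¹ : ℝ) • (r • e + z) ∈ A := by
      refine mem_of_nonneg_of_le_one hA hproj ?_ ?_ ?_ ?_
      · have h1 := smul_add_smul_mem_centralizer
          (Set.subset_centralizer_centralizer heA) hzA (((2 * r)⁻¹ * r : ℝ) : ℂ) (((2 * r)⁻¹ : ℝ) : ℂ)
        rwa [Complex.coe_smul, Complex.coe_smul, mul_smul, ← smul_add] at h1
      · intro v hv
        have hzv : z v = 0 := by rw [← hze, mul_apply_eq_comp, heker v hv, map_zero]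
        simp [heker v hv, hzv]
      · refine smul_nonneg (by positivity) ?_
        rw [← neg_le_iff_add_nonneg']
        exact hlow
      · calc ((2 * r)⁻¹ : ℝ) • (r • e + z) ≤ ((2 * r)⁻¹ : ℝ) • (r • e + r • e) :=
              smul_le_smul_of_nonneg_left (add_le_add_right hup _) (by positivity)
          _ = e := by
              rw [← add_smul, smul_smul, ← two_mul, inv_mul_cancel₀ (by positivity), one_smul]
          _ ≤ 1 := he1
    have hz' : z = ((2 * r : ℝ) : ℂ) • (((2 * r)⁻¹ : ℝ) • (r • e + z)) - (r : ℂ) • e := by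
      rw [Complex.coe_smul, Complex.coe_smul, smul_smul, mul_inv_cancel₀ (by positivity), one_smul,
        add_sub_cancel_left]
    rw [hz']
    exact sub_mem (SMulMemClass.smul_mem _ hw) (SMulMemClass.smul_mem _ heA)
  refine ⟨e, heA, hep, fun x => ⟨fun hx => ⟨Set.subset_centralizer_centralizer hx, ?_, hAe x hx⟩,
    fun ⟨hx, hex, hxe⟩ => ?_⟩⟩
  · have := congrArg star (hAe _ (star_mem hx))
    rwa [star_mul, star_star, hep.isSelfAdjoint.star_eq] at this
  · have hx' := mem_centralizer_centralizer_star hx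
    have hxe' : star x * e = star x := by
      have := congrArg star hex
      rwa [star_mul, hep.isSelfAdjoint.star_eq] at this
    have hre := hsa ((1 : ℂ) • x + (1 : ℂ) • star x)
      (by simp [isSelfAdjoint_iff, add_comm]) (smul_add_smul_mem_centralizer hx hx' _ _) (by simp [add_mul, hxe, hxe'])
    have him := hsa (Complex.I • x + (-Complex.I) • star x)
      (by simp [isSelfAdjoint_iff, add_comm]) (smul_add_smul_mem_centralizer hx hx' _ _) (by simp [add_mul, hxe, hxe'])
    have : x = (1 / 2 : ℂ) • ((1 : ℂ) • x + (1 : ℂ) • star x)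
        + (-(Complex.I / 2)) • (Complex.I • x + (-Complex.I) • star x) := by
      have hI : Complex.I / 2 * Complex.I = -(1 / 2) := by
        rw [div_mul_eq_mul_div, Complex.I_mul_I]; norm_num
      simp only [smul_add, smul_smul, neg_mul, mul_neg, neg_neg, hI, mul_one]
      module
    rw [this]
    exact add_mem (SMulMemClass.smul_mem _ hre) (SMulMemClass.smul_mem _ him)

end NonUnitalStarSubalgebra

theorem corollary2 {H : Type*} [NormedAddCommGroup H] [InnerProductSpace ℂ H] [CompleteSpace H]
    (M A : NonUnitalStarSubalgebra ℂ (H →L[ℂ] H))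
    (hM : M.IsVonNeumannAlgebra) (hσ : M.IsSigmaFinite)
    (hA : A.IsBorelStarAlgebra) (hAM : A ≤ M) :
    A.IsVonNeumannAlgebra := by
  refine NonUnitalStarSubalgebra.isVonNeumannAlgebra_of_isStarProjection_mem hA.isClosed
    fun p hp hpA hker => ?_
  obtain ⟨S, hSc, hS⟩ := hσ.exists_countable_separating hM
  -- Adding `0` makes the set nonempty, so that it is the range of a sequence.
  obtain ⟨ξ, hξ⟩ := (hSc.insert 0).exists_eq_range (Set.insert_nonempty _ _)
  obtain ⟨e, -, hep, hMe⟩ := hM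
  have hpM : p ∈ M := by
    -- The vector `v - e v` is killed by `M`, hence by `A`, hence by `p`.
    have hpe : p * e = p := by
      ext v
      have := hker (v - e v) fun a ha => by
        have := congrArg (fun T : H →L[ℂ] H => T v) ((hMe a).1 (hAM ha)).2.2
        rw [map_sub, sub_eq_zero]
        exact this.symm
      rw [map_sub, sub_eq_zero] at this
      exact this.symm
    refine (hMe p).2 ⟨Set.centralizer_subset (Set.centralizer_subset hAM) hpA, ?_, hpe⟩
    have := congrArg star hpe
    rwa [star_mul, hp.isSelfAdjoint.star_eq, hep.isSelfAdjoint.star_eq] at this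
  refine hA.mem_of_isStarProjection hp hpA hker ξ fun y hy hyξ => ?_
  refine sub_eq_zero.1 (hS (y - p) (sub_mem (hAM hy) hpM) fun v hv => ?_)
  obtain ⟨n, rfl⟩ : v ∈ Set.range ξ := hξ ▸ Set.mem_insert_of_mem _ hv
  rw [sub_apply, hyξ n, sub_self]
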